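/- Let $\mathcal H$ be a finite-dimensional complex Hilbert space, $P$ an orthogonal projection on $\mathcal H$, $Q = I - P$, and let $\rho$ be an operator on $\mathcal H$ (for instance a density matrix), with blocks $A = P\rho P$ on $P\mathcal H$, $B = P\rho Q : Q\mathcal H \to P\mathcal H$ and $C = Q\rho Q$ on $Q\mathcal H$. Put $$\Pi\rho = P\rho P + Q\rho Q = A \oplus C, \qquad M = \Pi\rho, \qquad Y = \rho - \Pi\rho,$$ and assume $M > 0$ (equivalently $A, C > 0$) and $M \pm Y \ge 0$. In particular $\rho = M + Y \ge 0$. Let $\Gamma > 0$ and consider the dephasing orbit $$\rho_t = M + e^{-\Gamma t} Y .$$ For $X \ge 0$ write $D(X\|M) = \operatorname{Tr}[X(\log X - \log M)]$ for the relative entropy (with $0 \log 0 = 0$), and $$\Omega_{A,C}^{-1}(B) = \int_0^\infty (A + r I_P)^{-1} B\, (C + r I_Q)^{-1}\, dr .$$ Then $\rho_0 = \rho$ and $\frac{d}{dt}\rho_t = \mathcal L(\rho_t)$ for all $t$, where $\mathcal L(\sigma) = -\Gamma (P\sigma Q + Q\sigma P)$, and for all $t \ge 0$ $$-\frac{d}{dt}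 D(\rho_t\|\Pi\rho) \;\ge\; 2\Gamma e^{-2\Gamma t}\, \operatorname{Tr}\!\left[B^* \Omega_{A,C}^{-1}(B)\right],$$ in the following sense. For every $t > 0$ the function $t \mapsto D(\rho_t\|\Pi\rho)$ is differentiable at $t$ and the inequality holds. At $t = 0$ the derivative is the right derivative. If $\rho$ is invertible, it exists as a real number and the inequality holds. If $\rho$ is singular, the right derivative of $D(\rho_t\|\Pi\rho)$ at $0$ is $-\infty$, so that the left side of the inequality is $+\infty$. -/

import Mathlib

open Filter Topology

noncomputable section

namespace Dephasing

variable {H : Type*} [NormedAddCommGroup H] [InnerProductSpace ℂ H] [CompleteSpace H]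
  [FiniteDimensional ℂ H]

/-- The orthogonal projection `P` of `H` onto the subspace `K`, so that `K = P H`. -/
abbrev P (K : Submodule ℂ H) : H →L[ℂ] H := K.starProjection

/-- The complementary projection `Q = I - P`, whose range is `Kᗮ`. -/
abbrev Q (K : Submodule ℂ H) : H →L[ℂ] H := 1 - P K

/-- The block-diagonal pinching `Π ρ = P ρ P + Q ρ Q = A ⊕ C`. -/
def pinching (K : Submodule ℂ H) (ρ : H →L[ℂ] H) : H →L[ℂ] H :=
  P K * ρ * P K + Q K * ρ * Q K

/-- The diagonal block `A = P ρ P`, as an operator on `P H`. -/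
def blockA (K : Submodule ℂ H) (ρ : H →L[ℂ] H) : K →L[ℂ] K :=
  K.orthogonalProjectionOnto ∘L ρ ∘L K.subtypeL

/-- The coherence block `B = P ρ Q`, as an operator from `Q H` to `P H`. -/
def blockB (K : Submodule ℂ H) (ρ : H →L[ℂ] H) : Kᗮ →L[ℂ] K :=
  K.orthogonalProjectionOnto ∘L ρ ∘L Kᗮ.subtypeL

/-- The diagonal block `C = Q ρ Q`, as an operator on `Q H`. -/
def blockC (K : Submodule ℂ H) (ρ : H →L[ℂ] H) : Kᗮ →L[ℂ] Kᗮ :=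
  Kᗮ.orthogonalProjectionOnto ∘L ρ ∘L Kᗮ.subtypeL

/-- The Umegaki relative entropy `D(ρ‖σ) = Tr[ρ (log ρ - log σ)]` of `ρ ≥ 0` with respect to a
strictly positive `σ`. As `Real.log 0 = 0`, the convention `0 log 0 = 0` is built in. The trace
is a real number for such `ρ` and `σ`. -/
def relEntropy (ρ σ : H →L[ℂ] H) : ℝ :=
  (LinearMap.trace ℂ H (ρ * (cfc Real.log ρ - cfc Real.log σ) : H →L[ℂ] H)).re

/-- The BKM kernel `Ω_{A,C}⁻¹(B) = ∫₀^∞ (A + r I)⁻¹ B (C + r I)⁻¹ dr`. For `A, C > 0` the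
operators `A + r I` and `C + r I` are invertible, and `Ring.inverse` is the true inverse. -/
def bkmKernel (K : Submodule ℂ H) (A : K →L[ℂ] K) (C : Kᗮ →L[ℂ] Kᗮ) (B : Kᗮ →L[ℂ] K) :
    Kᗮ →L[ℂ] K :=
  ∫ r in Set.Ioi (0 : ℝ), Ring.inverse (A + (r : ℂ) • 1) ∘L B ∘L Ring.inverse (C + (r : ℂ) • 1)

/-- The BKM form `Tr[B* Ω_{A,C}⁻¹(B)]` (a trace over `Q H`, real for `A, C > 0`) of the blocks
of `ρ`. -/
def bkmForm (K : Submodule ℂ H) (ρ : H →L[ℂ] H) : ℝ :=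
  (LinearMap.trace ℂ Kᗮ (ContinuousLinearMap.adjoint (blockB K ρ) ∘L
    bkmKernel K (blockA K ρ) (blockC K ρ) (blockB K ρ) : Kᗮ →L[ℂ] Kᗮ)).re

/-- The dephasing generator `𝓛(σ) = -Γ (P σ Q + Q σ P)`. -/
def generator (K : Submodule ℂ H) (Γ : ℝ) (σ : H →L[ℂ] H) : H →L[ℂ] H :=
  -((Γ : ℂ) • (P K * σ * Q K + Q K * σ * P K))

/-- The dephasing orbit `ρ_t = M + exp(-Γ t) Y`, where `M = Π ρ` and `Y = ρ - Π ρ`. -/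
def orbit (K : Submodule ℂ H) (Γ : ℝ) (ρ : H →L[ℂ] H) (t : ℝ) : H →L[ℂ] H :=
  pinching K ρ + (Real.exp (-Γ * t) : ℂ) • (ρ - pinching K ρ)

end Dephasing

end

set_option linter.unusedSectionVars false

noncomputable section

namespace Dephasing

variable {H : Type*} [NormedAddCommGroup H] [InnerProductSpace ℂ H] [CompleteSpace H]
  [FiniteDimensional ℂ H]

/-! Put s = exp(-Γt) and X = M + sY. The reflection U = P - Q commutes with M and satisfies UYU =
-Y, so Y has zero trace against everything commuting with P, in particular against 1 and log M.
Formally, then, dD/ds = Tr[Y log X], and the production is Γ s Tr[Y log X]; it remains to show Tr[Y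
log X] ≥ 2s · `bkmForm`.

Since Tr Y = 0, Tr[Y log X] = -∫ Tr[Y (X + r)⁻¹] dr over r > 0. With N = (M + r)⁻¹, averaging the
resolvents of M ± sY by means of U leaves s Tr[YNYN] plus a nonnegative trace
(`mul_reTrace_le_neg_reTrace_resolvent`). The integral of Tr[YNYN] is twice the BKM form, one copy
for each off-diagonal block (`bkmForm_eq_integral`).

The derivative formula is proved without differentiating the functional calculus. Klein's inequality
gives a supporting line at every strictly positive state of the orbit, and two such lines squeeze
the difference quotient once log is continuous. The argument is one-sided, so it covers t = 0 for
invertible ρ.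

For singular ρ, a kernel vector u has expectation (1 - s)⟨u, Mu⟩ in ρ_t, which forces an eigenvalue
of ρ_t to zero. As M > 0, Tr[Y log ρ_t] diverges logarithmically, and the supporting line at t,
evaluated at time 0, carries this to the slope. -/

/-- The real part of the trace, as a real-linear functional. -/
def reTrace : (H →L[ℂ] H) →ₗ[ℝ] ℝ where
  toFun X := (LinearMap.trace ℂ H (X : H →ₗ[ℂ] H)).re
  map_add' X Y := by simp
  map_smul' c X := by
    have : ((c • X : H →L[ℂ] H) : H →ₗ[ℂ] H) = (c : ℂ) • (X : H →ₗ[ℂ] H) := by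
      ext; simp
    rw [this]; simp

lemma reTrace_apply (X : H →L[ℂ] H) :
    reTrace X = (LinearMap.trace ℂ H (X : H →ₗ[ℂ] H)).re := rfl

lemma reTrace_mul_comm (X Y : H →L[ℂ] H) : reTrace (X * Y) = reTrace (Y * X) := by
  simp only [reTrace_apply, ContinuousLinearMap.toLinearMap_mul]
  rw [LinearMap.trace_mul_comm]

lemma reTrace_eq_sum {ι : Type*} [Fintype ι] (v : OrthonormalBasis ι ℂ H) (X : H →L[ℂ] H) :
    reTrace X = ∑ i, (inner ℂ (v i) (X (v i))).re := by
  rw [reTrace_apply, LinearMap.trace_eq_sum_inner _ v, Complex.re_sum]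
  rfl

lemma continuous_reTrace : Continuous (reTrace : (H →L[ℂ] H) →ₗ[ℝ] ℝ) :=
  LinearMap.continuous_of_finiteDimensional (E := H →L[ℂ] H) _

/-! ### Spectral calculus, trace inequalities and supporting lines -/

/-- The spectral theorem. -/
lemma exists_eigenbasis {X : H →L[ℂ] H} (hX : IsSelfAdjoint X) :
    ∃ (v : OrthonormalBasis (Fin (Module.finrank ℂ H)) ℂ H)
      (l : Fin (Module.finrank ℂ H) → ℝ), ∀ i, X (v i) = (l i : ℂ) • v i := by
  have h := hX.isSymmetric
  exact ⟨h.eigenvectorBasis rfl, h.eigenvalues rfl, fun i => h.apply_eigenvectorBasis rfl i⟩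

lemma aeval_apply_of_eigenvector {X : H →L[ℂ] H} {v : H} {l : ℝ} (hv : X v = (l : ℂ) • v)
    (p : Polynomial ℝ) : (Polynomial.aeval X p) v = ((p.eval l : ℝ) : ℂ) • v := by
  induction p using Polynomial.induction_on' with
  | add p q hp hq => simp [hp, hq, add_smul]
  | monomial n a =>
    have hpow : (X ^ n) v = (l : ℂ) ^ n • v := by
      induction n with
      | zero => simp
      | succ n ih => rw [pow_succ, mul_apply_eq_comp, hv, map_smul, ih, smul_smul,
          pow_succ, mul_comm]
    simp [Polynomial.aeval_monomial, hpow, Algebra.algebraMap_eq_smul_one]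
    rw [mul_smul, Complex.coe_smul]

lemma mem_spectrum_of_eigenvector {X : H →L[ℂ] H} {v : H} {l : ℝ} (hv : X v = (l : ℂ) • v)
    (h0 : v ≠ 0) : l ∈ spectrum ℝ X := by
  rw [spectrum.mem_iff]
  rintro ⟨u, hu⟩
  apply h0
  have h1 : (u : H →L[ℂ] H) v = 0 := by
    rw [hu, sub_apply, hv, Algebra.algebraMap_eq_smul_one]
    simp
  calc v = ((↑u⁻¹ * ↑u : H →L[ℂ] H)) v := by simp
    _ = 0 := by rw [mul_apply_eq_comp, h1, map_zero]

lemma finite_real_spectrum (X : H →L[ℂ] H) : (spectrum ℝ X).Finite := by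
  have h : (spectrum ℂ X).Finite := by
    rw [← AlgEquiv.spectrum_eq (Module.End.toContinuousLinearMap H).symm X]
    exact Module.End.finite_spectrum _
  rw [← spectrum.preimage_algebraMap ℂ]
  exact h.preimage (Complex.ofReal_injective.injOn)

/-- The spectrum is finite, so f may be replaced by an interpolating polynomial; no continuity of f
is assumed, and log is allowed at 0. -/
lemma cfc_apply_of_eigenvector {X : H →L[ℂ] H} (hX : IsSelfAdjoint X) {v : H} {l : ℝ}
    (hv : X v = (l : ℂ) • v) (f : ℝ → ℝ) : cfc f X v = ((f l : ℝ) : ℂ) • v := by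
  by_cases h0 : v = 0
  · simp [h0]
  have hfin := finite_real_spectrum X
  set p : Polynomial ℝ := Lagrange.interpolate hfin.toFinset id f
  have hp : ∀ x ∈ spectrum ℝ X, p.eval x = f x := fun x hx =>
    Lagrange.eval_interpolate_at_node f (Set.injOn_id _) (hfin.mem_toFinset.2 hx)
  have : cfc f X = Polynomial.aeval X p := by
    rw [← cfc_polynomial p X]
    exact cfc_congr fun x hx => (hp x hx).symm
  rw [this, aeval_apply_of_eigenvector hv, hp _ (mem_spectrum_of_eigenvector hv h0)]

lemma inner_apply_nonneg {X : H →L[ℂ] H} (hX : 0 ≤ X) (v : H) : 0 ≤ (inner ℂ v (X v)).re :=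
  ((ContinuousLinearMap.nonneg_iff_isPositive X).1 hX).re_inner_nonneg_right v

lemma eigenvalue_eq {X : H →L[ℂ] H} {v : H} {l : ℝ} (hv : X v = (l : ℂ) • v) (h1 : ‖v‖ = 1) :
    (inner ℂ v (X v)).re = l := by
  rw [hv, inner_smul_right, inner_self_eq_norm_sq_to_K, h1]; simp

lemma eigenvalue_nonneg {X : H →L[ℂ] H} (hX : 0 ≤ X) {v : H} {l : ℝ} (hv : X v = (l : ℂ) • v)
    (h1 : ‖v‖ = 1) : 0 ≤ l :=
  eigenvalue_eq hv h1 ▸ inner_apply_nonneg hX v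

lemma eigenvalue_pos {X : H →L[ℂ] H} (hX : IsStrictlyPositive X) {v : H} {l : ℝ}
    (hv : X v = (l : ℂ) • v) (h1 : ‖v‖ = 1) : 0 < l := by
  refine lt_of_le_of_ne (eigenvalue_nonneg hX.nonneg hv h1) ?_
  rintro rfl
  have h := mem_spectrum_of_eigenvector hv (by rintro rfl; simp at h1)
  exact spectrum.zero_notMem ℝ hX.isUnit h

/-- Parseval's identity, in the form used for double expansions of traces. -/
lemma sum_norm_inner_sq {ι : Type*} [Fintype ι] (v : OrthonormalBasis ι ℂ H) (x : H) :
    ∑ i, ‖inner ℂ (v i) x‖ ^ 2 = ‖x‖ ^ 2 :=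
  v.sum_sq_norm_inner_right x

lemma re_inner_apply_of_eigenbasis {ι : Type*} [Fintype ι] (v : OrthonormalBasis ι ℂ H)
    {X : H →L[ℂ] H} {l : ι → ℝ} (hv : ∀ i, X (v i) = (l i : ℂ) • v i) (x : H) :
    (inner ℂ x (X x)).re = ∑ i, l i * ‖inner ℂ (v i) x‖ ^ 2 := by
  have hx : X x = ∑ i, (inner ℂ (v i) x * l i) • v i := by
    conv_lhs => rw [← v.sum_repr' x]
    rw [map_sum]
    exact Finset.sum_congr rfl fun i _ => by rw [map_smul, hv, smul_smul]
  rw [hx, inner_sum, Complex.re_sum]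
  refine Finset.sum_congr rfl fun i _ => ?_
  rw [inner_smul_right, ← inner_conj_symm x (v i), mul_right_comm, Complex.mul_conj,
    ← Complex.ofReal_mul, Complex.ofReal_re, Complex.normSq_eq_norm_sq, mul_comm]

/-- The trace of a product of functions of two self-adjoint operators. -/
lemma reTrace_mul_of_eigenbasis {ι κ : Type*} [Fintype ι] [Fintype κ]
    (v : OrthonormalBasis ι ℂ H) (w : OrthonormalBasis κ ℂ H)
    {X Z : H →L[ℂ] H} {l : ι → ℝ} {m : κ → ℝ} (hv : ∀ i, X (v i) = (l i : ℂ) • v i)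
    (hw : ∀ j, Z (w j) = (m j : ℂ) • w j) :
    reTrace (X * Z) = ∑ j, ∑ i, l i * m j * ‖inner ℂ (v i) (w j)‖ ^ 2 := by
  rw [reTrace_eq_sum w]
  refine Finset.sum_congr rfl fun j _ => ?_
  rw [mul_apply_eq_comp, hw, map_smul, inner_smul_right, Complex.re_ofReal_mul,
    re_inner_apply_of_eigenbasis v hv, Finset.mul_sum]
  exact Finset.sum_congr rfl fun i _ => by ring

lemma reTrace_mul_eq_sum {ι : Type*} [Fintype ι] (v : OrthonormalBasis ι ℂ H)
    (Z : H →L[ℂ] H) {X : H →L[ℂ] H} {l : ι → ℝ} (hv : ∀ i, X (v i) = (l i : ℂ) • v i) :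
    reTrace (Z * X) = ∑ i, l i * (inner ℂ (v i) (Z (v i))).re := by
  rw [reTrace_eq_sum v]
  refine Finset.sum_congr rfl fun j _ => ?_
  rw [mul_apply_eq_comp, hv, map_smul, inner_smul_right, Complex.re_ofReal_mul]

lemma reTrace_mul_nonneg {X Z : H →L[ℂ] H} (hX : 0 ≤ X) (hZ : 0 ≤ Z) :
    0 ≤ reTrace (X * Z) := by
  obtain ⟨v, l, hv⟩ := exists_eigenbasis hZ.isSelfAdjoint
  rw [reTrace_mul_eq_sum v X hv]
  exact Finset.sum_nonneg fun i _ => mul_nonneg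
    (eigenvalue_nonneg hZ (hv i) (v.norm_eq_one i)) (inner_apply_nonneg hX _)

/-- Scalar Klein inequality, from log x ≤ x - 1 at x = b / a. The case a = 0 uses 0 log 0 = 0. -/
lemma mul_log_sub_mul_log_ge {a b : ℝ} (ha : 0 ≤ a) (hb : 0 < b) :
    a - b ≤ a * Real.log a - a * Real.log b := by
  rcases ha.eq_or_lt with rfl | ha
  · simp [hb.le]
  have h := Real.log_le_sub_one_of_pos (div_pos hb ha)
  rw [Real.log_div hb.ne' ha.ne'] at h
  have h2 := mul_le_mul_of_nonneg_left h ha.le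
  have : a * (b / a - 1) = b - a := by field_simp
  linarith

/-- Klein's inequality. -/
lemma klein {X Z : H →L[ℂ] H} (hX : 0 ≤ X) (hZ : IsStrictlyPositive Z) :
    reTrace X - reTrace Z ≤ reTrace (X * (cfc Real.log X - cfc Real.log Z)) := by
  obtain ⟨v, l, hv⟩ := exists_eigenbasis hX.isSelfAdjoint
  obtain ⟨w, m, hw⟩ := exists_eigenbasis hZ.isSelfAdjoint
  -- Inserting the identity as an operator diagonal in either basis turns every trace into a double
  -- sum with the same weights |⟨v i, w j⟩|², so the scalar inequality applies termwise.
  have one : ∀ j, (1 : H →L[ℂ] H) (w j) = ((1 : ℝ) : ℂ) • w j := fun j => by simp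
  have one' : ∀ i, (1 : H →L[ℂ] H) (v i) = ((1 : ℝ) : ℂ) • v i := fun i => by simp
  have hXX : ∀ i, (X * cfc Real.log X) (v i) = ((l i * Real.log (l i) : ℝ) : ℂ) • v i :=
    fun i => by
      rw [mul_apply_eq_comp, cfc_apply_of_eigenvector hX.isSelfAdjoint (hv i),
        map_smul, hv, smul_smul]
      push_cast; rw [mul_comm]
  have hZZ := fun j => cfc_apply_of_eigenvector hZ.isSelfAdjoint (hw j) Real.log
  have e1 : reTrace X = _ := (congrArg reTrace (mul_one X).symm).trans
    (reTrace_mul_of_eigenbasis v w hv one)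
  have e2 : reTrace Z = _ := (congrArg reTrace (one_mul Z).symm).trans
    (reTrace_mul_of_eigenbasis v w one' hw)
  have e3 : reTrace (X * cfc Real.log X) = _ := (congrArg reTrace (mul_one _).symm).trans
    (reTrace_mul_of_eigenbasis v w hXX one)
  rw [mul_sub, map_sub, e1, e2, e3, reTrace_mul_of_eigenbasis v w hv hZZ]
  simp only [← Finset.sum_sub_distrib]
  refine Finset.sum_le_sum fun j _ => Finset.sum_le_sum fun i _ => ?_
  have h := mul_le_mul_of_nonneg_right (mul_log_sub_mul_log_ge
    (eigenvalue_nonneg hX (hv i) (v.norm_eq_one i)) (eigenvalue_pos hZ (hw j) (w.norm_eq_one j)))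
    (sq_nonneg ‖inner ℂ (v i) (w j)‖)
  nlinarith [h]

/-- Differentiation by a two-sided supporting-line bound. -/
lemma hasDerivWithinAt_of_support {G φ h : ℝ → ℝ} {S : Set ℝ} {t φ' : ℝ}
    (hφ : HasDerivWithinAt φ φ' S t) (hh : ContinuousWithinAt h S t) (ht : t ∈ S)
    (hs : ∀ x ∈ S, ∀ y ∈ S, (φ y - φ x) * h x ≤ G y - G x) :
    HasDerivWithinAt G (φ' * h t) S t := by
  rw [hasDerivWithinAt_iff_isLittleO] at hφ ⊢
  have hO : (fun y => φ y - φ t) =O[𝓝[S] t] fun y => y - t := by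
    have h1 : (fun y => (y - t) • φ') =O[𝓝[S] t] fun y => y - t := by
      simpa [mul_comm] using Asymptotics.isBigO_const_mul_self φ' (fun y => y - t) (𝓝[S] t)
    simpa using hφ.isBigO.add h1
  have ho : (fun y => h y - h t) =o[𝓝[S] t] fun _ => (1 : ℝ) := by
    rw [Asymptotics.isLittleO_one_iff]
    simpa using hh.sub_const (h t)
  have hprod : (fun y => (φ y - φ t) * (h y - h t)) =o[𝓝[S] t] fun y => y - t := by
    simpa using hO.mul_isLittleO ho
  -- The supporting lines at t and at y place this remainder between 0 and (φ y - φ t)(h y - h t).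
  have hrest : (fun y => G y - G t - (φ y - φ t) * h t) =o[𝓝[S] t] fun y => y - t := by
    refine Asymptotics.IsBigO.trans_isLittleO (Asymptotics.IsBigO.of_bound 1 ?_) hprod
    filter_upwards [self_mem_nhdsWithin] with y hy
    have h1 := hs t ht y hy
    have h2 := hs y hy t ht
    rw [one_mul, Real.norm_eq_abs, Real.norm_eq_abs, abs_of_nonneg (by linarith)]
    exact le_trans (by linarith) (le_abs_self _)
  refine (hrest.add (hφ.const_mul_left (h t))).congr_left fun y => ?_
  simp only [smul_eq_mul]
  ring

/-! ### The resolvent inequality and the integral for the logarithm -/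

/-- The second order term of the resolvent along an off-diagonal perturbation is a lower bound. -/
lemma mul_reTrace_le_neg_reTrace_resolvent {U Y R N X : H →L[ℂ] H} {s : ℝ} (hs : 0 ≤ s)
    (hU : U * U = 1) (hUs : star U = U) (hY : IsSelfAdjoint Y) (hUY : U * Y * U = -Y)
    (hUR : U * R * U = R)
    (hN : 0 ≤ N) (hNR : N * R = 1) (hRN : R * N = 1)
    (hX : 0 ≤ X) (hXR : X * (R + s • Y) = 1) (hRX : (R + s • Y) * X = 1) :
    s * reTrace (Y * N * Y * N) ≤ -reTrace (Y * X) := by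
  -- X' is the inverse of R - sY; conjugation by U gives it positivity for free.
  obtain ⟨X', hX'⟩ : ∃ X', X' = U * X * U := ⟨_, rfl⟩
  have hconj : U * (R + s • Y) * U = R - s • Y := by
    rw [mul_add, add_mul, hUR, mul_smul_comm, smul_mul_assoc, hUY, smul_neg, sub_eq_add_neg]
  have hX'0 : 0 ≤ X' := by
    have := star_left_conjugate_nonneg hX U
    rwa [hUs, ← hX'] at this
  have hXR' : X' * (R - s • Y) = 1 := by
    rw [← hconj, hX']
    calc U * X * U * (U * (R + s • Y) * U) = U * X * (U * U) * (R + s • Y) * U := by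
          simp only [mul_assoc]
      _ = U * (X * (R + s • Y)) * U := by rw [hU, mul_one]; simp only [mul_assoc]
      _ = 1 := by rw [hXR, mul_one, hU]
  have hRX' : (R - s • Y) * X' = 1 := by
    rw [← hconj, hX']
    calc U * (R + s • Y) * U * (U * X * U) = U * (R + s • Y) * (U * U) * X * U := by
          simp only [mul_assoc]
      _ = U * ((R + s • Y) * X) * U := by rw [hU, mul_one]; simp only [mul_assoc]
      _ = 1 := by rw [hRX, mul_one, hU]
  have e1 : X = N - s • (N * Y * X) := by
    have : N * ((R + s • Y) * X) = N := by rw [hRX, mul_one]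
    rw [add_mul, mul_add, ← mul_assoc, hNR, one_mul, smul_mul_assoc, mul_smul_comm,
      ← mul_assoc] at this
    exact eq_sub_of_add_eq this
  have e2 : X = N - s • (X * Y * N) := by
    have : X * (R + s • Y) * N = N := by rw [hXR, one_mul]
    rw [mul_add, add_mul, mul_assoc, hRN, mul_one, mul_smul_comm, smul_mul_assoc] at this
    exact eq_sub_of_add_eq this
  have e1' : X' = N + s • (N * Y * X') := by
    have : N * ((R - s • Y) * X') = N := by rw [hRX', mul_one]
    rw [sub_mul, mul_sub, ← mul_assoc, hNR, one_mul, smul_mul_assoc, mul_smul_comm,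
      ← mul_assoc] at this
    exact eq_add_of_sub_eq this
  have e2' : X' = N + s • (X' * Y * N) := by
    have : X' * (R - s • Y) * N = N := by rw [hXR', one_mul]
    rw [mul_sub, sub_mul, mul_assoc, hRN, mul_one, mul_smul_comm, smul_mul_assoc] at this
    exact eq_add_of_sub_eq this
  obtain ⟨W, hW⟩ : ∃ W, W = X + X' := ⟨_, rfl⟩
  have d1 : X - X' = -(s • (N * Y * W)) := by
    rw [hW, mul_add, smul_add]
    nth_rewrite 1 [e1]
    nth_rewrite 1 [e1']
    abel
  have d2 : X - X' = -(s • (W * Y * N)) := by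
    rw [hW, add_mul, add_mul, smul_add]
    nth_rewrite 1 [e2]
    nth_rewrite 1 [e2']
    abel
  -- The even part X + X' reproduces itself between NY and YN, so its correction to 2N is positive.
  -- This needs the resolvent identity with N on the left and on the right.
  have hW2 : W = (2 : ℝ) • N + (s * s) • (N * Y * W * Y * N) := by
    have : W = (2 : ℝ) • N - s • (N * Y * (X - X')) := by
      rw [hW, mul_sub, smul_sub, two_smul]
      nth_rewrite 1 [e1]
      nth_rewrite 1 [e1']
      abel
    rw [d2] at this
    nth_rewrite 1 [this]
    rw [mul_neg, smul_neg, sub_neg_eq_add, mul_smul_comm, smul_smul]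
    simp only [mul_assoc]
  have hflip : reTrace (Y * X') = -reTrace (Y * X) := by
    rw [hX', ← mul_assoc, reTrace_mul_comm, ← mul_assoc, ← mul_assoc, hUY, neg_mul, map_neg]
  have hmain : 2 * reTrace (Y * X) =
      -(s * (2 * reTrace (Y * N * Y * N)
        + s * s * reTrace ((Y * N * Y) * (N * Y * W * Y * N)))) := by
    calc 2 * reTrace (Y * X) = reTrace (Y * (X - X')) := by
          rw [mul_sub, map_sub, hflip]; ring
      _ = -(s * reTrace (Y * N * Y * W)) := by
          rw [d1, mul_neg, map_neg, mul_smul_comm, map_smul, smul_eq_mul]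
          simp only [mul_assoc]
      _ = _ := by
          nth_rewrite 1 [hW2]
          rw [mul_add, map_add, mul_smul_comm, mul_smul_comm, map_smul, map_smul, smul_eq_mul,
            smul_eq_mul]
  have hWpos : 0 ≤ W := hW ▸ add_nonneg hX hX'0
  have hp1 : 0 ≤ Y * N * Y := by
    have := star_left_conjugate_nonneg hN Y
    rwa [hY.star_eq] at this
  have hp2 : 0 ≤ N * Y * W * Y * N := by
    have := star_left_conjugate_nonneg hWpos (Y * N)
    rw [star_mul, hY.star_eq, (IsSelfAdjoint.of_nonneg hN).star_eq] at this
    simpa only [mul_assoc] using this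
  have hp := reTrace_mul_nonneg hp1 hp2
  -- The term discarded: a trace of a product of two positive operators.
  have : 0 ≤ s * (s * s * reTrace ((Y * N * Y) * (N * Y * W * Y * N))) := by positivity
  linarith

lemma isStrictlyPositive_add_smul_one {X : H →L[ℂ] H} (hX : IsStrictlyPositive X) {r : ℝ}
    (hr : 0 ≤ r) : IsStrictlyPositive (X + r • (1 : H →L[ℂ] H)) :=
  hX.add_nonneg (smul_nonneg hr zero_le_one)

lemma ringInverse_apply_of_eigenvector {X : H →L[ℂ] H} (hX : IsStrictlyPositive X) {r : ℝ}
    (hr : 0 ≤ r) {v : H} {l : ℝ} (hv : X v = (l : ℂ) • v) (hv1 : ‖v‖ = 1) :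
    Ring.inverse (X + r • (1 : H →L[ℂ] H)) v = (((l + r)⁻¹ : ℝ) : ℂ) • v := by
  have hu := (isStrictlyPositive_add_smul_one hX hr).isUnit
  have hl : l + r ≠ 0 := (add_pos_of_pos_of_nonneg (eigenvalue_pos hX hv hv1) hr).ne'
  have h1 : (X + r • (1 : H →L[ℂ] H)) v = ((l + r : ℝ) : ℂ) • v := by
    rw [add_apply, hv, Complex.ofReal_add, add_smul]
    simp
  have h2 : Ring.inverse (X + r • (1 : H →L[ℂ] H)) ((X + r • (1 : H →L[ℂ] H)) v) = v := by
    rw [← mul_apply_eq_comp, Ring.inverse_mul_cancel _ hu]; rfl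
  rw [h1, map_smul] at h2
  conv_rhs => rw [← h2, smul_smul, ← Complex.ofReal_mul, inv_mul_cancel₀ hl]
  simp

/-- The integral representation of the logarithm, tested against a traceless operator. -/
lemma integral_resolvent_eq_log {X Y : H →L[ℂ] H} (hX : IsStrictlyPositive X)
    (hY : reTrace Y = 0)
    (hpos : ∀ r : ℝ, 0 ≤ r → 0 ≤ -reTrace (Y * Ring.inverse (X + r • (1 : H →L[ℂ] H)))) :
    MeasureTheory.IntegrableOn
      (fun r : ℝ => -reTrace (Y * Ring.inverse (X + r • (1 : H →L[ℂ] H)))) (Set.Ioi 0) ∧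
    ∫ r in Set.Ioi (0 : ℝ), -reTrace (Y * Ring.inverse (X + r • (1 : H →L[ℂ] H)))
      = reTrace (Y * cfc Real.log X) := by
  obtain ⟨v, l, hv⟩ := exists_eigenbasis hX.isSelfAdjoint
  set c : Fin (Module.finrank ℂ H) → ℝ := fun i => (inner ℂ (v i) (Y (v i))).re
  have hl : ∀ i, 0 < l i := fun i => eigenvalue_pos hX (hv i) (v.norm_eq_one i)
  have hc : ∑ i, c i = 0 := (reTrace_eq_sum v Y).symm.trans hY
  have hres : ∀ r : ℝ, 0 ≤ r → -reTrace (Y * Ring.inverse (X + r • (1 : H →L[ℂ] H)))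
      = -∑ i, (l i + r)⁻¹ * c i := fun r hr => by
    rw [reTrace_mul_eq_sum v Y fun i =>
      ringInverse_apply_of_eigenvector hX hr (hv i) (v.norm_eq_one i)]
  have hlog : reTrace (Y * cfc Real.log X) = ∑ i, Real.log (l i) * c i :=
    reTrace_mul_eq_sum v Y fun i => cfc_apply_of_eigenvector hX.isSelfAdjoint (hv i) _
  have hderiv : ∀ r ∈ Set.Ici (0 : ℝ), HasDerivAt (fun r => -∑ i, Real.log (l i + r) * c i)
      (-reTrace (Y * Ring.inverse (X + r • (1 : H →L[ℂ] H)))) r := fun r hr => by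
    rw [hres r hr]
    refine (HasDerivAt.fun_sum fun i _ => ?_).neg
    have h1 : HasDerivAt (fun r => l i + r) 1 r := (hasDerivAt_id r).const_add (l i)
    have h2 := (h1.log (add_pos_of_pos_of_nonneg (hl i) hr).ne').mul_const (c i)
    rwa [one_div] at h2
  -- As the c i sum to zero, log r can be subtracted from each logarithm, and the antiderivative
  -- vanishes at infinity. Integrability then comes from the sign of the integrand.
  have hlim : Tendsto (fun r => -∑ i, Real.log (l i + r) * c i) atTop (𝓝 0) := by
    have h1 : (fun r => -∑ i, Real.log (l i + r) * c i)
        = fun r => -∑ i, (Real.log (r + l i) - Real.log r) * c i := by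
      ext r
      simp only [sub_mul, Finset.sum_sub_distrib, ← Finset.mul_sum, hc, mul_zero, sub_zero,
        add_comm]
    rw [h1]
    have h2 : Tendsto (fun r => -∑ i, (Real.log (r + l i) - Real.log r) * c i) atTop
        (𝓝 (-∑ i, 0 * c i)) :=
      (tendsto_finsetSum _ fun i _ =>
        (Real.tendsto_log_comp_add_sub_log (l i)).mul_const (c i)).neg
    simpa using h2
  refine ⟨MeasureTheory.integrableOn_Ioi_deriv_of_nonneg' hderiv
    (fun r hr => hpos r (le_of_lt hr)) hlim, ?_⟩
  rw [MeasureTheory.integral_Ioi_of_hasDerivAt_of_nonneg' hderiv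
    (fun r hr => hpos r (le_of_lt hr)) hlim, hlog]
  simp

/-- The product is dominated by the sum of the two squares, each integrable. -/
lemma integrableOn_inv_mul_inv {a b : ℝ} (ha : 0 < a) (hb : 0 < b) :
    MeasureTheory.IntegrableOn (fun r : ℝ => (a + r)⁻¹ * (b + r)⁻¹) (Set.Ioi 0) := by
  have key : ∀ c : ℝ, 0 < c →
      MeasureTheory.IntegrableOn (fun r : ℝ => (c + r)⁻¹ ^ 2) (Set.Ioi 0) := fun c hc => by
    have h := integrableOn_add_rpow_Ioi_of_lt (a := -2) (c := 0) (m := c) (by norm_num)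
      (by linarith)
    refine h.congr_fun (fun r hr => ?_) measurableSet_Ioi
    have hr' : 0 < r + c := add_pos hr hc
    simp only
    rw [Real.rpow_neg hr'.le, add_comm c r, inv_pow]
    norm_cast
  refine MeasureTheory.Integrable.mono' ((key a ha).add (key b hb)) ?_ ?_
  · exact Measurable.aestronglyMeasurable (by fun_prop)
  · refine (MeasureTheory.ae_restrict_iff' measurableSet_Ioi).2 (Filter.Eventually.of_forall fun r hr => ?_)
    have hr : 0 < r := hr
    have h1 : 0 ≤ (a + r)⁻¹ * (b + r)⁻¹ := by positivity
    rw [Real.norm_of_nonneg h1]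
    simp only [Pi.add_apply]
    nlinarith [sq_nonneg ((a + r)⁻¹ - (b + r)⁻¹), sq_nonneg ((a + r)⁻¹ + (b + r)⁻¹)]

/-- Sandwiches between resolvents of a strictly positive operator are integrable. -/
lemma integrableOn_resolvent_mul_resolvent {M : H →L[ℂ] H} (hM : IsStrictlyPositive M)
    (Z : H →L[ℂ] H) :
    MeasureTheory.IntegrableOn (fun r : ℝ => Ring.inverse (M + r • (1 : H →L[ℂ] H)) * Z *
      Ring.inverse (M + r • (1 : H →L[ℂ] H))) (Set.Ioi 0) := by
  obtain ⟨v, l, hv⟩ := exists_eigenbasis hM.isSelfAdjoint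
  have hl : ∀ i, 0 < l i := fun i => eigenvalue_pos hM (hv i) (v.norm_eq_one i)
  set E : Fin (Module.finrank ℂ H) → (H →L[ℂ] H) :=
    fun i => InnerProductSpace.rankOne ℂ (v i) (v i)
  have hN : ∀ r : ℝ, 0 < r → Ring.inverse (M + r • (1 : H →L[ℂ] H))
      = ∑ i, (l i + r)⁻¹ • E i := fun r hr => by
    ext x
    conv_lhs => rw [← v.sum_repr' x]
    rw [map_sum, sum_apply]
    refine Finset.sum_congr rfl fun i _ => ?_
    rw [map_smul, ringInverse_apply_of_eigenvector hM hr.le (hv i) (v.norm_eq_one i),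
      smul_apply, InnerProductSpace.rankOne_apply, smul_comm, Complex.coe_smul]
  have hint : MeasureTheory.IntegrableOn
      (fun r : ℝ => ∑ i, ∑ j, ((l i + r)⁻¹ * (l j + r)⁻¹) • (E i * Z * E j)) (Set.Ioi 0) :=
    MeasureTheory.integrable_finsetSum _ fun i _ => MeasureTheory.integrable_finsetSum _
      fun j _ => (integrableOn_inv_mul_inv (hl i) (hl j)).smul_const _
  refine hint.congr_fun (fun r hr => ?_) measurableSet_Ioi
  simp only
  rw [hN r hr, Finset.sum_mul, Finset.sum_mul]
  refine Finset.sum_congr rfl fun i _ => ?_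
  rw [Finset.mul_sum]
  refine Finset.sum_congr rfl fun j _ => ?_
  rw [smul_mul_assoc, smul_mul_assoc, mul_smul_comm, smul_smul]

/-! ### Block algebra of the pinching and the BKM form -/

section Blocks

variable (K : Submodule ℂ H)

lemma P_mul_P : P K * P K = P K := K.isIdempotentElem_starProjection

lemma P_mul_Q : P K * Q K = 0 := by rw [mul_sub, mul_one, P_mul_P, sub_self]

lemma Q_mul_P : Q K * P K = 0 := by rw [sub_mul, one_mul, P_mul_P, sub_self]

lemma Q_mul_Q : Q K * Q K = Q K := by
  nth_rewrite 1 [Q]; rw [sub_mul, one_mul, P_mul_Q, sub_zero]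

lemma P_orthogonal : P Kᗮ = Q K := K.starProjection_orthogonal'

lemma Q_orthogonal : Q Kᗮ = P K := by rw [Q, P_orthogonal]; simp

lemma star_P : star (P K) = P K := (isSelfAdjoint_starProjection K).star_eq

lemma star_Q : star (Q K) = Q K := by rw [star_sub, star_one, star_P]

/-- The reflection `P - Q`. -/
def reflection : H →L[ℂ] H := P K - Q K

lemma reflection_mul_P : reflection K * P K = P K := by
  rw [reflection, sub_mul (P K) (Q K), P_mul_P, Q_mul_P, sub_zero]

lemma reflection_mul_Q : reflection K * Q K = -Q K := by
  rw [reflection, sub_mul (P K) (Q K), P_mul_Q, Q_mul_Q, zero_sub]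

lemma P_mul_reflection : P K * reflection K = P K := by
  rw [reflection, mul_sub (P K) (P K) (Q K), P_mul_P, P_mul_Q, sub_zero]

lemma Q_mul_reflection : Q K * reflection K = -Q K := by
  rw [reflection, mul_sub (Q K) (P K) (Q K), Q_mul_P, Q_mul_Q, zero_sub]

lemma reflection_mul_self : reflection K * reflection K = 1 := by
  nth_rewrite 2 [reflection]
  rw [mul_sub (reflection K) (P K) (Q K), reflection_mul_P, reflection_mul_Q]
  simp

lemma star_reflection : star (reflection K) = reflection K := by
  rw [reflection, star_sub, star_P, star_Q]

variable (ρ : H →L[ℂ] H)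

/-- Symmetry under exchange of P and Q: block C for `K` is block A for `Kᗮ`, so one resolvent lemma
serves both. -/
lemma pinching_orthogonal : pinching Kᗮ ρ = pinching K ρ := by
  rw [pinching, pinching, P_orthogonal, Q_orthogonal, add_comm]

lemma P_mul_pinching : P K * pinching K ρ = P K * ρ * P K := by
  rw [pinching, mul_add]; simp only [← mul_assoc]; rw [P_mul_P, P_mul_Q]; simp

lemma pinching_mul_P : pinching K ρ * P K = P K * ρ * P K := by
  rw [pinching, add_mul]; simp only [mul_assoc]; rw [P_mul_P, Q_mul_P]; simp

lemma commute_P_pinching : Commute (P K) (pinching K ρ) :=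
  (P_mul_pinching K ρ).trans (pinching_mul_P K ρ).symm

lemma commute_reflection {Z : H →L[ℂ] H} (h : Commute (P K) Z) : Commute (reflection K) Z :=
  h.sub_left ((Commute.one_left Z).sub_left h)

lemma sub_pinching : ρ - pinching K ρ = P K * ρ * Q K + Q K * ρ * P K := by
  simp only [pinching, Q, mul_sub, sub_mul, mul_one, one_mul]
  abel

lemma reflection_mul_sub_pinching :
    reflection K * (ρ - pinching K ρ) * reflection K = -(ρ - pinching K ρ) := by
  rw [sub_pinching, mul_add, add_mul]
  simp only [← mul_assoc, reflection_mul_P, reflection_mul_Q]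
  rw [mul_assoc _ (Q K) (reflection K), mul_assoc _ (P K) (reflection K), P_mul_reflection,
    Q_mul_reflection]
  simp only [neg_mul, mul_neg, neg_add]

/-- Conjugation by the reflection preserves the trace and fixes L but changes the sign of the
off-diagonal part. -/
lemma reTrace_sub_pinching_mul {L : H →L[ℂ] H} (hL : Commute (P K) L) :
    reTrace ((ρ - pinching K ρ) * L) = 0 := by
  set Y := ρ - pinching K ρ
  have h1 : reTrace (reflection K * Y * reflection K * L) = reTrace (Y * L) := by
    rw [mul_assoc, (commute_reflection K hL).eq, reTrace_mul_comm]
    calc reTrace (L * reflection K * (reflection K * Y))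
        = reTrace (L * (reflection K * reflection K) * Y) := by simp only [mul_assoc]
      _ = reTrace (Y * L) := by rw [reflection_mul_self, mul_one, reTrace_mul_comm]
  rw [reflection_mul_sub_pinching, neg_mul, map_neg] at h1
  linarith

lemma generator_orbit (Γ t : ℝ) : generator K Γ (orbit K Γ ρ t)
    = -((Γ : ℂ) • ((Real.exp (-Γ * t) : ℂ) • (ρ - pinching K ρ))) := by
  have h1 : P K * pinching K ρ * Q K = 0 := by
    rw [P_mul_pinching, mul_assoc, P_mul_Q, mul_zero]
  have h2 : Q K * pinching K ρ * P K = 0 := by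
    rw [mul_assoc, pinching_mul_P, ← mul_assoc, ← mul_assoc, Q_mul_P, zero_mul, zero_mul]
  have e : P K * orbit K Γ ρ t * Q K + Q K * orbit K Γ ρ t * P K
      = (Real.exp (-Γ * t) : ℂ) • (P K * ρ * Q K + Q K * ρ * P K) := by
    have key : ∀ S T : H →L[ℂ] H, S * pinching K ρ * T = 0 →
        S * orbit K Γ ρ t * T = (Real.exp (-Γ * t) : ℂ) • (S * ρ * T) := fun S T h => by
      rw [orbit, mul_add, add_mul, h, zero_add, mul_smul_comm, smul_mul_assoc, mul_sub, sub_mul,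
        h, sub_zero]
    rw [key _ _ h1, key _ _ h2, smul_add]
  rw [generator, e, ← sub_pinching]

lemma orbit_eq (Γ t : ℝ) :
    orbit K Γ ρ t = pinching K ρ + Real.exp (-Γ * t) • (ρ - pinching K ρ) := by
  rw [orbit, Complex.coe_smul]

lemma hasDerivAt_exp_neg_mul (Γ t : ℝ) :
    HasDerivAt (fun t => Real.exp (-Γ * t)) (-Γ * Real.exp (-Γ * t)) t := by
  have h := ((hasDerivAt_id t).const_mul (-Γ)).exp
  simpa [mul_comm] using h

lemma hasDerivAt_orbit (Γ t : ℝ) :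
    HasDerivAt (orbit K Γ ρ) (generator K Γ (orbit K Γ ρ t)) t := by
  have h := ((hasDerivAt_exp_neg_mul Γ t).smul_const (ρ - pinching K ρ)).const_add (pinching K ρ)
  have e : orbit K Γ ρ
      = fun t => pinching K ρ + Real.exp (-Γ * t) • (ρ - pinching K ρ) :=
    funext fun t => orbit_eq K ρ Γ t
  rw [generator_orbit, e, Complex.coe_smul, Complex.coe_smul, smul_smul, ← neg_smul, ← neg_mul]
  exact h

lemma orbit_zero (Γ : ℝ) : orbit K Γ ρ 0 = ρ := by simp [orbit]

lemma blockA_eq : blockA K ρ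
    = K.orthogonalProjectionOnto ∘L pinching K ρ ∘L K.subtypeL := by
  ext x
  have hP : P K (x : H) = x := K.starProjection_eq_self_iff.2 x.2
  have hQ : Q K (x : H) = 0 := by rw [sub_apply, hP]; simp
  simp only [blockA, pinching, ContinuousLinearMap.comp_apply, Submodule.subtypeL_apply,
    add_apply, mul_apply_eq_comp, hP, hQ, map_zero, add_zero]
  change (P K) (ρ x) = P K (P K (ρ x))
  rw [← mul_apply_eq_comp (P K) (P K), P_mul_P]

/-- The resolvent of the block is the block of the resolvent. -/
lemma ringInverse_blockA_add {r : ℝ} (hu : IsUnit (pinching K ρ + r • (1 : H →L[ℂ] H))) :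
    Ring.inverse (blockA K ρ + (r : ℂ) • 1)
      = K.orthogonalProjectionOnto ∘L Ring.inverse (pinching K ρ + r • (1 : H →L[ℂ] H)) ∘L
        K.subtypeL := by
  set R := pinching K ρ + r • (1 : H →L[ℂ] H)
  set N := Ring.inverse R
  have hNR : N * R = 1 := Ring.inverse_mul_cancel _ hu
  have hRN : R * N = 1 := Ring.mul_inverse_cancel _ hu
  have hR : Commute (P K) R := (commute_P_pinching K ρ).add_right
    ((Commute.one_right _).smul_right r)
  have hA : blockA K ρ + (r : ℂ) • 1 = K.orthogonalProjectionOnto ∘L R ∘L K.subtypeL := by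
    rw [blockA_eq]
    ext x
    simp [R]
  -- Compression to `K` is multiplicative as soon as the left factor commutes with P.
  have hcomp : ∀ S T : H →L[ℂ] H, Commute (P K) S →
      (K.orthogonalProjectionOnto ∘L S ∘L K.subtypeL) *
        (K.orthogonalProjectionOnto ∘L T ∘L K.subtypeL)
      = K.orthogonalProjectionOnto ∘L (S * T) ∘L K.subtypeL := fun S T hS => by
    ext x
    change P K (S (P K (T x))) = P K (S (T x))
    rw [← mul_apply_eq_comp S, ← hS.eq, mul_apply_eq_comp, ← mul_apply_eq_comp, P_mul_P]
  have hN : Commute (P K) N := by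
    have : N * (P K * R) * N = N * (R * P K) * N := by rw [hR.eq]
    calc P K * N = N * (R * P K) * N := by rw [← mul_assoc N, hNR, one_mul]
      _ = N * (P K * R) * N := this.symm
      _ = N * P K := by rw [mul_assoc, mul_assoc, hRN, mul_one]
  have hone : K.orthogonalProjectionOnto ∘L (1 : H →L[ℂ] H) ∘L K.subtypeL = 1 := by
    ext x; simp
  have h1 := hcomp R N hR
  have h2 := hcomp N R hN
  rw [hRN, hone] at h1
  rw [hNR, hone] at h2
  rw [hA]
  exact Ring.inverse_unit (⟨_, _, h1, h2⟩ : (K →L[ℂ] K)ˣ)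

lemma commute_ringInverse {S R : H →L[ℂ] H} (hR : Commute S R) (hu : IsUnit R) :
    Commute S (Ring.inverse R) := by
  obtain ⟨u, rfl⟩ := hu
  rw [Ring.inverse_unit]
  exact hR.units_inv_right

/-- The BKM form of the blocks, as a trace over the full space. -/
lemma bkmForm_eq_integral (hM : IsStrictlyPositive (pinching K ρ)) (hρ : IsSelfAdjoint ρ) :
    MeasureTheory.IntegrableOn (fun r : ℝ =>
      reTrace ((ρ - pinching K ρ) * Ring.inverse (pinching K ρ + r • (1 : H →L[ℂ] H)) *
        (ρ - pinching K ρ) * Ring.inverse (pinching K ρ + r • (1 : H →L[ℂ] H)))) (Set.Ioi 0) ∧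
    ∫ r in Set.Ioi (0 : ℝ),
      reTrace ((ρ - pinching K ρ) * Ring.inverse (pinching K ρ + r • (1 : H →L[ℂ] H)) *
        (ρ - pinching K ρ) * Ring.inverse (pinching K ρ + r • (1 : H →L[ℂ] H)))
      = 2 * bkmForm K ρ := by
  set N : ℝ → (H →L[ℂ] H) := fun r => Ring.inverse (pinching K ρ + r • (1 : H →L[ℂ] H))
  have hu : ∀ r : ℝ, 0 < r → IsUnit (pinching K ρ + r • (1 : H →L[ℂ] H)) :=
    fun r hr => (isStrictlyPositive_add_smul_one hM hr.le).isUnit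
  have hint := integrableOn_resolvent_mul_resolvent hM (P K * ρ * Q K)
  have hcomm : ∀ r : ℝ, 0 < r → Commute (P K) (N r) := fun r hr =>
    commute_ringInverse ((commute_P_pinching K ρ).add_right
      ((Commute.one_right _).smul_right r)) (hu r hr)
  -- the trace over the full space splits into two equal blocks
  have hsplit : ∀ r ∈ Set.Ioi (0 : ℝ),
      reTrace ((ρ - pinching K ρ) * N r * (ρ - pinching K ρ) * N r)
        = 2 * reTrace ((Q K * ρ * P K) * (N r * (P K * ρ * Q K) * N r)) := fun r hr => by
    have hP := hcomm r hr
    have hQ : Commute (Q K) (N r) := (Commute.one_left _).sub_left hP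
    have z1 : (P K * ρ * Q K) * N r * (P K * ρ * Q K) = 0 := by
      rw [mul_assoc (P K * ρ), hQ.eq]
      simp only [mul_assoc]
      rw [← mul_assoc (Q K) (P K), Q_mul_P]
      simp
    have z2 : (Q K * ρ * P K) * N r * (Q K * ρ * P K) = 0 := by
      rw [mul_assoc (Q K * ρ), hP.eq]
      simp only [mul_assoc]
      rw [← mul_assoc (P K) (Q K), P_mul_Q]
      simp
    have hc : reTrace ((P K * ρ * Q K) * N r * (Q K * ρ * P K) * N r)
        = reTrace ((Q K * ρ * P K) * N r * (P K * ρ * Q K) * N r) := by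
      rw [mul_assoc _ _ (N r), reTrace_mul_comm]
      simp only [mul_assoc]
    rw [sub_pinching]
    simp only [add_mul, mul_add]
    rw [z1, z2]
    simp only [zero_mul, zero_add, add_zero, map_add]
    rw [hc, ← two_mul]
    simp only [mul_assoc]
  obtain ⟨Φ, hΦ⟩ : ∃ Φ : (H →L[ℂ] H) →L[ℝ] ℝ, ∀ W, Φ W = reTrace ((Q K * ρ * P K) * W) :=
    ⟨LinearMap.toContinuousLinearMap (E := H →L[ℂ] H)
      (reTrace ∘ₗ LinearMap.mulLeft ℝ (Q K * ρ * P K)), fun W => rfl⟩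
  have hΦint := Φ.integrable_comp hint
  -- The compression is written as a continuous linear map so that it can be pulled out of the
  -- Bochner integral.
  have hcompress : ∀ r ∈ Set.Ioi (0 : ℝ),
      Ring.inverse (blockA K ρ + (r : ℂ) • 1) ∘L blockB K ρ ∘L
        Ring.inverse (blockC K ρ + (r : ℂ) • 1)
      = ((ContinuousLinearMap.compL ℂ Kᗮ H K K.orthogonalProjectionOnto) ∘L
          ((ContinuousLinearMap.compL ℂ Kᗮ H H).flip Kᗮ.subtypeL))
        (N r * (P K * ρ * Q K) * N r) := fun r hr => by
    have hC := ringInverse_blockA_add Kᗮ ρ (r := r) (by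
      rw [pinching_orthogonal]; exact hu r hr)
    rw [pinching_orthogonal] at hC
    rw [ringInverse_blockA_add K ρ (hu r hr), show blockC K ρ = blockA Kᗮ ρ from rfl, hC]
    ext x
    rw [← P_orthogonal]
    rfl
  have hkernel : bkmKernel K (blockA K ρ) (blockC K ρ) (blockB K ρ)
      = K.orthogonalProjectionOnto ∘L
        (∫ r in Set.Ioi (0 : ℝ), N r * (P K * ρ * Q K) * N r) ∘L Kᗮ.subtypeL := by
    rw [bkmKernel, MeasureTheory.setIntegral_congr_fun measurableSet_Ioi hcompress,
      ContinuousLinearMap.integral_comp_comm _ hint]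
    rfl
  have hadj : ContinuousLinearMap.adjoint (blockB K ρ)
      = Kᗮ.orthogonalProjectionOnto ∘L ρ ∘L K.subtypeL := by
    rw [blockB, ContinuousLinearMap.adjoint_comp, ContinuousLinearMap.adjoint_comp,
      Submodule.adjoint_subtypeL, Submodule.adjoint_orthogonalProjectionOnto,
      ContinuousLinearMap.isSelfAdjoint_iff'.1 hρ]
    rfl
  have hform : bkmForm K ρ = Φ (∫ r in Set.Ioi (0 : ℝ), N r * (P K * ρ * Q K) * N r) := by
    set W := ∫ r in Set.Ioi (0 : ℝ), N r * (P K * ρ * Q K) * N r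
    rw [bkmForm, hkernel, hadj, hΦ, reTrace_apply]
    have h := LinearMap.trace_comp_comm' (R := ℂ)
      ((Kᗮ.orthogonalProjectionOnto ∘L ρ ∘L P K ∘L W : H →L[ℂ] Kᗮ) : H →ₗ[ℂ] Kᗮ)
      (Kᗮ.subtypeL : Kᗮ →ₗ[ℂ] H)
    have e2 : (Kᗮ.subtypeL : Kᗮ →ₗ[ℂ] H) ∘ₗ
        ((Kᗮ.orthogonalProjectionOnto ∘L ρ ∘L P K ∘L W : H →L[ℂ] Kᗮ) : H →ₗ[ℂ] Kᗮ)
        = ((Q K * ρ * P K * W : H →L[ℂ] H) : H →ₗ[ℂ] H) := by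
      ext x
      rw [← P_orthogonal]
      rfl
    rw [← e2, h]
    rfl
  refine ⟨?_, ?_⟩
  · refine MeasureTheory.IntegrableOn.congr_fun (hΦint.const_mul 2) (fun r hr => ?_)
      measurableSet_Ioi
    rw [hsplit r hr]
    simp only [hΦ]
    rfl
  · rw [MeasureTheory.setIntegral_congr_fun measurableSet_Ioi hsplit,
      MeasureTheory.integral_const_mul, hform, ← ContinuousLinearMap.integral_comp_comm _ hint]
    simp only [hΦ]
    rfl

end Blocks

/-! ### Entropy production along strictly positive states -/

section Production

variable (K : Submodule ℂ H) (ρ : H →L[ℂ] H)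

/-- The BKM form bounds the logarithmic force along the off-diagonal direction from below. -/
lemma bkmForm_le_reTrace_log (hM : IsStrictlyPositive (pinching K ρ)) (hρ : IsSelfAdjoint ρ)
    {s : ℝ} (hs : 0 ≤ s)
    (hX : IsStrictlyPositive (pinching K ρ + s • (ρ - pinching K ρ))) :
    2 * s * bkmForm K ρ ≤ reTrace ((ρ - pinching K ρ) *
      cfc Real.log (pinching K ρ + s • (ρ - pinching K ρ))) := by
  obtain ⟨hint, hval⟩ := bkmForm_eq_integral K ρ hM hρ
  set M := pinching K ρ
  set Y := ρ - M
  have hY : IsSelfAdjoint Y := hρ.sub hM.isSelfAdjoint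
  have hY0 : reTrace Y = 0 := by
    have h := reTrace_sub_pinching_mul K ρ (Commute.one_right (P K))
    rwa [mul_one] at h
  have hres : ∀ r : ℝ, 0 ≤ r →
      s * reTrace (Y * Ring.inverse (M + r • (1 : H →L[ℂ] H)) * Y *
        Ring.inverse (M + r • (1 : H →L[ℂ] H)))
      ≤ -reTrace (Y * Ring.inverse (M + s • Y + r • (1 : H →L[ℂ] H))) := fun r hr => by
    have hR := isStrictlyPositive_add_smul_one hM hr
    have hXr := isStrictlyPositive_add_smul_one hX hr
    have hcomm : Commute (reflection K) (M + r • (1 : H →L[ℂ] H)) :=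
      commute_reflection K ((commute_P_pinching K ρ).add_right
        ((Commute.one_right _).smul_right r))
    refine mul_reTrace_le_neg_reTrace_resolvent hs (reflection_mul_self K) (star_reflection K) hY
      (reflection_mul_sub_pinching K ρ) ?_ hR.ringInverse.nonneg
      (Ring.inverse_mul_cancel _ hR.isUnit) (Ring.mul_inverse_cancel _ hR.isUnit)
      hXr.ringInverse.nonneg ?_ ?_
    · rw [hcomm.eq, mul_assoc, reflection_mul_self, mul_one]
    · rw [add_right_comm M, Ring.inverse_mul_cancel]
      rw [add_right_comm]; exact hXr.isUnit
    · rw [add_right_comm M (s • Y), Ring.mul_inverse_cancel]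
      rw [add_right_comm]; exact hXr.isUnit
  have hnn : ∀ r : ℝ, 0 ≤ r → 0 ≤ s * reTrace (Y * Ring.inverse (M + r • (1 : H →L[ℂ] H)) * Y *
        Ring.inverse (M + r • (1 : H →L[ℂ] H))) := fun r hr => by
    have hN := (isStrictlyPositive_add_smul_one hM hr).ringInverse.nonneg
    have h1 := star_left_conjugate_nonneg hN Y
    rw [hY.star_eq] at h1
    exact mul_nonneg hs (reTrace_mul_nonneg h1 hN)
  obtain ⟨hint', hval'⟩ := integral_resolvent_eq_log hX hY0
    fun r hr => (hnn r hr).trans (hres r hr)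
  rw [← hval', show 2 * s * bkmForm K ρ = s * (2 * bkmForm K ρ) by ring, ← hval,
    ← MeasureTheory.integral_const_mul]
  exact MeasureTheory.setIntegral_mono_on (hint.const_mul s) hint' measurableSet_Ioi
    fun r hr => hres r (le_of_lt hr)

/-- The supporting-line inequality for the relative entropy along the orbit. -/
lemma relEntropy_orbit_support (Γ : ℝ) {x y : ℝ}
    (hx : IsStrictlyPositive (orbit K Γ ρ x)) (hy : 0 ≤ orbit K Γ ρ y) :
    (Real.exp (-Γ * y) - Real.exp (-Γ * x)) *
        reTrace ((ρ - pinching K ρ) * cfc Real.log (orbit K Γ ρ x))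
      ≤ relEntropy (orbit K Γ ρ y) (pinching K ρ) - relEntropy (orbit K Γ ρ x) (pinching K ρ) := by
  have hY0 : reTrace (ρ - pinching K ρ) = 0 := by
    have h := reTrace_sub_pinching_mul K ρ (Commute.one_right (P K))
    rwa [mul_one] at h
  have hlogM : reTrace ((ρ - pinching K ρ) * cfc Real.log (pinching K ρ)) = 0 :=
    reTrace_sub_pinching_mul K ρ
      ((commute_P_pinching K ρ).symm.cfc_real Real.log).symm
  have hdiff : ∀ L : H →L[ℂ] H, reTrace (orbit K Γ ρ y * L) - reTrace (orbit K Γ ρ x * L)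
      = (Real.exp (-Γ * y) - Real.exp (-Γ * x)) * reTrace ((ρ - pinching K ρ) * L) := fun L => by
    rw [orbit_eq, orbit_eq, ← map_sub, ← sub_mul, add_sub_add_left_eq_sub, ← sub_smul,
      smul_mul_assoc, map_smul, smul_eq_mul]
  -- All states of the orbit have the same trace, so the left side of Klein's inequality vanishes.
  have hklein := klein hy hx
  have htr := hdiff 1
  rw [mul_one, mul_one, mul_one, hY0, mul_zero] at htr
  have h1 := hdiff (cfc Real.log (orbit K Γ ρ x))
  have h2 := hdiff (cfc Real.log (pinching K ρ))
  rw [hlogM, mul_zero] at h2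
  have e : ∀ X Z : H →L[ℂ] H, relEntropy X Z
      = reTrace (X * cfc Real.log X) - reTrace (X * cfc Real.log Z) := fun X Z => by
    rw [← map_sub, ← mul_sub]; rfl
  rw [e, e, ← h1]
  rw [mul_sub, map_sub] at hklein
  linarith

/-- The derivative of the relative entropy along the orbit. -/
lemma hasDerivWithinAt_relEntropy_orbit (Γ : ℝ) {S : Set ℝ} {t : ℝ} (ht : t ∈ S)
    (hS : ∀ x ∈ S, IsStrictlyPositive (orbit K Γ ρ x)) :
    HasDerivWithinAt (fun s => relEntropy (orbit K Γ ρ s) (pinching K ρ))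
      (-Γ * Real.exp (-Γ * t) * reTrace ((ρ - pinching K ρ) * cfc Real.log (orbit K Γ ρ t)))
      S t := by
  refine hasDerivWithinAt_of_support (hasDerivAt_exp_neg_mul Γ t).hasDerivWithinAt
    (h := fun t => reTrace ((ρ - pinching K ρ) * cfc Real.log (orbit K Γ ρ t))) ?_ ht
    fun x hx y hy => relEntropy_orbit_support K ρ Γ (hS x hx) (hS y hy).nonneg
  have hlog : ContinuousOn (fun t => cfc Real.log (orbit K Γ ρ t)) S :=
    (CFC.continuousOn_log (A := H →L[ℂ] H)).comp
      (fun t _ => (hasDerivAt_orbit K ρ Γ t).continuousAt.continuousWithinAt)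
      fun x hx => ⟨(hS x hx).isSelfAdjoint, (hS x hx).isUnit⟩
  exact (continuous_reTrace.continuousAt.comp_continuousWithinAt
    ((continuousWithinAt_const).mul (hlog t ht)))

variable {K ρ}

/-- The state is the convex combination (1 - s) M + s ρ with s < 1. -/
lemma isStrictlyPositive_orbit {Γ : ℝ} (hΓ : 0 < Γ) (hM : IsStrictlyPositive (pinching K ρ))
    (hρ : 0 ≤ ρ) {t : ℝ} (ht : 0 < t) : IsStrictlyPositive (orbit K Γ ρ t) := by
  set s := Real.exp (-Γ * t)
  have hs1 : s < 1 := Real.exp_lt_one_iff.2 (by nlinarith)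
  have e : orbit K Γ ρ t = (1 - s) • pinching K ρ + s • ρ := by
    rw [orbit_eq, smul_sub, sub_smul, one_smul]; abel
  rw [e]
  exact (hM.smul (sub_pos.2 hs1)).add_nonneg (smul_nonneg (Real.exp_nonneg _) hρ)

lemma exists_entropy_production {Γ : ℝ} (hΓ : 0 < Γ) (hM : IsStrictlyPositive (pinching K ρ))
    (hρ : 0 ≤ ρ) {S : Set ℝ} {t : ℝ} (ht : t ∈ S)
    (hS : ∀ x ∈ S, IsStrictlyPositive (orbit K Γ ρ x)) :
    ∃ d : ℝ, HasDerivWithinAt (fun s => relEntropy (orbit K Γ ρ s) (pinching K ρ)) d S t ∧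
      2 * Γ * Real.exp (-2 * Γ * t) * bkmForm K ρ ≤ -d := by
  refine ⟨_, hasDerivWithinAt_relEntropy_orbit K ρ Γ ht hS, ?_⟩
  have hX := hS t ht
  rw [orbit_eq] at hX ⊢
  have h := bkmForm_le_reTrace_log K ρ hM (IsSelfAdjoint.of_nonneg hρ) (Real.exp_nonneg _) hX
  have h2 := mul_le_mul_of_nonneg_left h
    (mul_nonneg hΓ.le (Real.exp_nonneg (-Γ * t)))
  have e : Real.exp (-2 * Γ * t) = Real.exp (-Γ * t) * Real.exp (-Γ * t) := by
    rw [← Real.exp_add]; congr 1; ring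
  rw [e]
  linarith

end Production

/-! ### Divergence at a singular initial state -/

section Singular

lemma exists_pos_mul_sq_le {M : H →L[ℂ] H} [Nontrivial H] (hM : IsStrictlyPositive M) :
    ∃ m : ℝ, 0 < m ∧ ∀ x : H, m * ‖x‖ ^ 2 ≤ (inner ℂ x (M x)).re := by
  obtain ⟨m, hm, hle⟩ := (CFC.exists_pos_algebraMap_le_iff hM.isSelfAdjoint).2
    fun x hx => hM.spectrum_pos hx
  refine ⟨m, hm, fun x => ?_⟩
  have h := inner_apply_nonneg (sub_nonneg.2 hle) x
  have e : (algebraMap ℝ (H →L[ℂ] H) m) x = (m : ℂ) • x := by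
    rw [Algebra.algebraMap_eq_smul_one, smul_apply, one_apply_eq_self, Complex.coe_smul]
  rw [sub_apply, inner_sub_right, Complex.sub_re, e, inner_smul_right, Complex.re_ofReal_mul,
    inner_self_eq_norm_sq_to_K] at h
  have e2 : (((‖x‖ : ℝ) : ℂ) ^ 2).re = ‖x‖ ^ 2 := by rw [← Complex.ofReal_pow, Complex.ofReal_re]
  erw [e2] at h
  linarith

lemma exists_unit_kernel {ρ : H →L[ℂ] H} (h : ¬ IsUnit ρ) : ∃ u : H, ‖u‖ = 1 ∧ ρ u = 0 := by
  by_contra hne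
  push Not at hne
  apply h
  have hinj : Function.Injective (ρ : H →ₗ[ℂ] H) := by
    rw [← LinearMap.ker_eq_bot, LinearMap.ker_eq_bot']
    intro x hx
    by_contra hx0
    refine hne ((‖x‖⁻¹ : ℂ) • x) (norm_smul_inv_norm hx0) ?_
    rw [map_smul]
    exact (congrArg _ hx).trans (smul_zero _)
  have hU : IsUnit (ρ : H →ₗ[ℂ] H) := (Module.End.isUnit_iff _).2
    ⟨hinj, LinearMap.injective_iff_surjective.1 hinj⟩
  exact hU.map (Module.End.toContinuousLinearMap H)

/-- An expectation value is a weighted mean of eigenvalues, so some eigenvalue does not exceed it.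
-/
lemma exists_eigenvalue_le {ι : Type*} [Fintype ι] (v : OrthonormalBasis ι ℂ H)
    {X : H →L[ℂ] H} {l : ι → ℝ} (hv : ∀ i, X (v i) = (l i : ℂ) • v i) {u : H} (hu : ‖u‖ = 1) :
    ∃ i, l i ≤ (inner ℂ u (X u)).re := by
  by_contra! hlt
  set b := (inner ℂ u (X u)).re
  have h1 := sum_norm_inner_sq v u
  have h2 : b = _ := re_inner_apply_of_eigenbasis v hv u
  have h3 : ∑ i, (l i - b) * ‖inner ℂ (v i) u‖ ^ 2 = 0 := by
    simp only [sub_mul, Finset.sum_sub_distrib, ← Finset.mul_sum]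
    rw [h1, hu, ← h2]; ring
  have h4 := (Finset.sum_eq_zero_iff_of_nonneg fun i _ =>
    mul_nonneg (sub_pos.2 (hlt i)).le (sq_nonneg _)).1 h3
  have h5 : ∑ i, ‖inner ℂ (v i) u‖ ^ 2 = 0 := Finset.sum_eq_zero fun i hi =>
    (mul_eq_zero.1 (h4 i hi)).resolve_left (sub_pos.2 (hlt i)).ne'
  rw [h1, hu] at h5
  norm_num at h5

/-- If `X` has a small expectation value, then `Tr[(X - M) log X]` is large. -/
lemma reTrace_sub_mul_log_ge {M X : H →L[ℂ] H} (hX : IsStrictlyPositive X) {m C b : ℝ}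
    (hm : 0 < m) (hmM : ∀ x : H, m * ‖x‖ ^ 2 ≤ (inner ℂ x (M x)).re) (hC : 1 ≤ C) (hXC : ‖X‖ ≤ C)
    {u : H} (hu : ‖u‖ = 1) (hb : (inner ℂ u (X u)).re = b) :
    -(Module.finrank ℂ H : ℝ) - Real.log C * reTrace M - m * Real.log b
      ≤ reTrace ((X - M) * cfc Real.log X) := by
  obtain ⟨v, l, hv⟩ := exists_eigenbasis hX.isSelfAdjoint
  have hl : ∀ i, 0 < l i := fun i => eigenvalue_pos hX (hv i) (v.norm_eq_one i)
  have hlC : ∀ i, l i ≤ C := fun i => by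
    have h := X.le_opNorm (v i)
    rw [hv, norm_smul, v.norm_eq_one, mul_one, mul_one, Complex.norm_real] at h
    exact (le_abs_self _).trans (h.trans hXC)
  have hlogC : 0 ≤ Real.log C := Real.log_nonneg hC
  have hlog := fun i => cfc_apply_of_eigenvector hX.isSelfAdjoint (hv i) Real.log
  obtain ⟨k, hk⟩ := exists_eigenvalue_le v hv hu
  rw [hb] at hk
  have hkb : Real.log (l k) ≤ Real.log b := Real.log_le_log (hl k) hk
  have hMi : ∀ i, m ≤ (inner ℂ (v i) (M (v i))).re := fun i => by
    have h := hmM (v i); rwa [v.norm_eq_one, one_pow, mul_one] at h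
  have h1 : -(Module.finrank ℂ H : ℝ) ≤ reTrace (X * cfc Real.log X) := by
    rw [reTrace_mul_eq_sum v X hlog]
    have : -(Module.finrank ℂ H : ℝ) = ∑ _i : Fin (Module.finrank ℂ H), (-1 : ℝ) := by simp
    rw [this]
    refine Finset.sum_le_sum fun i _ => ?_
    rw [eigenvalue_eq (hv i) (v.norm_eq_one i)]
    have h := mul_log_sub_mul_log_ge (hl i).le one_pos
    rw [Real.log_one, mul_zero, sub_zero] at h
    linarith [hl i]
  -- After subtracting log C every term is nonpositive, so only the small eigenvalue l k need be
  -- kept, with weight at least m. The leftover -m log C is dropped because C ≥ 1.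
  have h2 : reTrace (M * cfc Real.log X) ≤ Real.log C * reTrace M + m * Real.log b := by
    rw [reTrace_mul_eq_sum v M hlog, reTrace_eq_sum v M, Finset.mul_sum, ← sub_le_iff_le_add',
      ← Finset.sum_sub_distrib]
    have hneg : ∀ i, Real.log (l i) * (inner ℂ (v i) (M (v i))).re
        - Real.log C * (inner ℂ (v i) (M (v i))).re ≤ 0 := fun i => by
      rw [← sub_mul]
      exact mul_nonpos_of_nonpos_of_nonneg
        (sub_nonpos.2 (Real.log_le_log (hl i) (hlC i))) (hm.le.trans (hMi i))
    have hsingle := Finset.single_le_sum (fun i _ => neg_nonneg.2 (hneg i)) (Finset.mem_univ k)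
    rw [Finset.sum_neg_distrib] at hsingle
    refine (neg_le_neg_iff.1 hsingle).trans ?_
    rw [← sub_mul]
    have hle : Real.log (l k) - Real.log C ≤ 0 :=
      sub_nonpos.2 (Real.log_le_log (hl k) (hlC k))
    have := mul_le_mul_of_nonpos_left (hMi k) hle
    nlinarith
  rw [sub_mul, map_sub]
  linarith

variable {K : Submodule ℂ H} {ρ : H →L[ℂ] H}

/-- From a singular state, the entropy production is infinite at time zero. -/
lemma tendsto_slope_relEntropy_atBot {Γ : ℝ} (hΓ : 0 < Γ)
    (hM : IsStrictlyPositive (pinching K ρ)) (hρ : 0 ≤ ρ) (hsing : ¬ IsUnit ρ) :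
    Tendsto (slope (fun s => relEntropy (orbit K Γ ρ s) (pinching K ρ)) 0) (𝓝[>] 0) atBot := by
  obtain ⟨u, hu, hρu⟩ := exists_unit_kernel hsing
  have : Nontrivial H := ⟨u, 0, by rintro rfl; simp at hu⟩
  obtain ⟨m, hm, hmM⟩ := exists_pos_mul_sq_le hM
  set M := pinching K ρ
  set Y := ρ - M
  set a := (inner ℂ u (M u)).re
  have ha : 0 < a := by
    have h := hmM u
    rw [hu, one_pow, mul_one] at h
    exact hm.trans_le h
  set C := 1 + ‖M‖ + ‖Y‖
  have hC : 1 ≤ C := by have := norm_nonneg M; have := norm_nonneg Y; linarith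
  set φ : ℝ → ℝ := fun t => Real.exp (-Γ * t)
  set g : ℝ → ℝ := fun t => reTrace (Y * cfc Real.log (orbit K Γ ρ t))
  set B : ℝ → ℝ := fun t => -(Module.finrank ℂ H : ℝ) - Real.log C * reTrace M
    - m * Real.log ((1 - φ t) * a)
  have hB : Tendsto B (𝓝[>] 0) atTop := by
    have hφ : Tendsto (fun t => (1 - φ t) * a) (𝓝[>] 0) (𝓝[>] 0) := by
      refine tendsto_nhdsWithin_iff.2 ⟨?_, ?_⟩
      · have hc : Continuous fun t => (1 - φ t) * a := by fun_prop
        have := hc.tendsto 0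
        simp only [φ, mul_zero, Real.exp_zero, sub_self, zero_mul] at this
        exact this.mono_left nhdsWithin_le_nhds
      · filter_upwards [self_mem_nhdsWithin] with t ht
        have ht : 0 < t := ht
        exact mul_pos (sub_pos.2 (Real.exp_lt_one_iff.2 (by nlinarith))) ha
    have h := (Real.tendsto_log_nhdsGT_zero.comp hφ).const_mul_atBot hm
    have h' := tendsto_atTop_add_const_left _
      (-(Module.finrank ℂ H : ℝ) - Real.log C * reTrace M) (tendsto_neg_atBot_atTop.comp h)
    refine h'.congr fun t => ?_
    simp [B, sub_eq_add_neg]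
  have hforce : ∀ t, 0 < t → B t ≤ φ t * g t := fun t ht => by
    have hφ0 : 0 ≤ φ t := Real.exp_nonneg _
    have hφ1 : φ t < 1 := Real.exp_lt_one_iff.2 (by nlinarith)
    have hXe : orbit K Γ ρ t = M + φ t • Y := orbit_eq K ρ Γ t
    have hnorm : ‖orbit K Γ ρ t‖ ≤ C := by
      rw [hXe]
      refine (norm_add_le _ _).trans ?_
      rw [norm_smul, Real.norm_of_nonneg hφ0]
      nlinarith [norm_nonneg Y]
    -- On the kernel vector, ρ u = 0 means Y u = -M u.
    have hexp : (inner ℂ u (orbit K Γ ρ t u)).re = (1 - φ t) * a := by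
      have : orbit K Γ ρ t u = ((1 - φ t : ℝ) : ℂ) • M u := by
        rw [hXe, add_apply, smul_apply, sub_apply, hρu, zero_sub, Complex.coe_smul, sub_smul,
          one_smul, smul_neg, sub_eq_add_neg]
      rw [this, inner_smul_right, Complex.re_ofReal_mul]
    have h := reTrace_sub_mul_log_ge (isStrictlyPositive_orbit hΓ hM hρ ht) hm hmM hC hnorm hu
      hexp
    have e : orbit K Γ ρ t - M = φ t • Y := by rw [hXe, add_sub_cancel_left]
    rw [e, smul_mul_assoc, map_smul, smul_eq_mul] at h
    exact h
  have hlim : Tendsto (fun t => -Γ * B t) (𝓝[>] 0) atBot :=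
    hB.const_mul_atTop_of_neg (neg_lt_zero.2 hΓ)
  refine tendsto_atBot_mono' _ ?_ hlim
  filter_upwards [self_mem_nhdsWithin, hB.eventually_ge_atTop 0] with t ht hBt
  have ht : 0 < t := ht
  -- Only the base point t must be strictly positive; the other end may be the singular state at 0.
  have hsup := relEntropy_orbit_support K ρ Γ (isStrictlyPositive_orbit hΓ hM hρ ht)
    (y := 0) (by rwa [orbit_zero])
  rw [mul_zero, Real.exp_zero] at hsup
  have hF := hforce t ht
  have hexp : φ t * Real.exp (Γ * t) = 1 := by
    simp only [φ]; rw [← Real.exp_add]; simp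
  -- This is 1 + Γt ≤ exp(Γt) multiplied by exp(-Γt); it bounds the slope above by -Γ φ g, hence by
  -- -Γ B.
  have hge : Γ * t * φ t ≤ 1 - φ t := by
    have := mul_le_mul_of_nonneg_left (Real.add_one_le_exp (Γ * t)) (Real.exp_nonneg (-Γ * t))
    change φ t * _ ≤ φ t * _ at this
    linarith
  have hg : 0 ≤ g t :=
    nonneg_of_mul_nonneg_right (hBt.trans hF) (Real.exp_pos _)
  have h1 := mul_le_mul_of_nonneg_right hge hg
  have h2 := mul_le_mul_of_nonneg_left hF (mul_nonneg hΓ.le ht.le)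
  rw [slope_def_field, sub_zero, div_le_iff₀ ht]
  change (1 - φ t) * g t ≤ _ at hsup
  linarith

end Singular

end Dephasing

end

theorem corollary5p1 {H : Type*} [NormedAddCommGroup H] [InnerProductSpace ℂ H]
    [CompleteSpace H] [FiniteDimensional ℂ H]
    (K : Submodule ℂ H) (ρ M Y : H →L[ℂ] H) (Γ : ℝ) (hΓ : 0 < Γ)
    (hM : M = Dephasing.pinching K ρ) (hY : Y = ρ - Dephasing.pinching K ρ)
    (hMpos : IsStrictlyPositive M) (hadd : 0 ≤ M + Y) (hsub : 0 ≤ M - Y) :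
    -- the orbit is the solution of `ρ' = 𝓛 ρ` that starts at `ρ`
    (Dephasing.orbit K Γ ρ 0 = ρ ∧
      ∀ t : ℝ, HasDerivAt (Dephasing.orbit K Γ ρ)
        (Dephasing.generator K Γ (Dephasing.orbit K Γ ρ t)) t) ∧
    -- entropy production at positive times
    (∀ t : ℝ, 0 < t → ∃ d : ℝ,
      HasDerivAt (fun s => Dephasing.relEntropy (Dephasing.orbit K Γ ρ s) M) d t ∧
      2 * Γ * Real.exp (-2 * Γ * t) * Dephasing.bkmForm K ρ ≤ -d) ∧
    -- entropy production at time zero, for invertible `ρ`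
    (IsUnit ρ → ∃ d : ℝ,
      HasDerivWithinAt (fun s => Dephasing.relEntropy (Dephasing.orbit K Γ ρ s) M) d
        (Set.Ici 0) 0 ∧
      2 * Γ * Dephasing.bkmForm K ρ ≤ -d) ∧
    -- at time zero, for singular `ρ`, the entropy production is `+∞`
    (¬ IsUnit ρ →
      Tendsto (slope (fun s => Dephasing.relEntropy (Dephasing.orbit K Γ ρ s) M) 0)
        (𝓝[>] 0) atBot) := by
  subst hY
  subst hM
  have hρ : 0 ≤ ρ := by rwa [add_sub_cancel] at hadd
  refine ⟨⟨Dephasing.orbit_zero K ρ Γ, Dephasing.hasDerivAt_orbit K ρ Γ⟩, fun t ht => ?_,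
    fun hunit => ?_, Dephasing.tendsto_slope_relEntropy_atBot hΓ hMpos hρ⟩
  · obtain ⟨d, hd, hle⟩ := Dephasing.exists_entropy_production hΓ hMpos hρ (S := Set.Ioi 0) ht
      fun x hx => Dephasing.isStrictlyPositive_orbit hΓ hMpos hρ hx
    exact ⟨d, hd.hasDerivAt (Ioi_mem_nhds ht), hle⟩
  · obtain ⟨d, hd, hle⟩ := Dephasing.exists_entropy_production hΓ hMpos hρ (S := Set.Ici 0)
      Set.self_mem_Ici fun x hx => by
        rcases (Set.mem_Ici.1 hx).eq_or_lt with rfl | hx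
        · rw [Dephasing.orbit_zero]
          exact hunit.isStrictlyPositive hρ
        · exact Dephasing.isStrictlyPositive_orbit hΓ hMpos hρ hx
    refine ⟨d, hd, ?_⟩
    rwa [mul_zero, Real.exp_zero, mul_one] at hle
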